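/- Let $X=(X(t))_{t\in T}$, $T\subset\mathbb R^d$, be a real-valued, centred, square-integrable process, let $t_1,\dots,t_p\in T$, $x=(X(t_1),\dots,X(t_p))^\top$, $\Sigma=\mathbb E(xx^\top)$ and $\Phi=V(\mathrm{vec}(xx^\top))$ (the covariance matrix of $\mathrm{vec}(xx^\top)$). Let $\|A\|=\sqrt{\mathrm{Tr}(AA^\top)}$. Let $(g_\lambda)_{\lambda\in\Lambda}$ be a countable family of functions $T\to\mathbb R$ and $\mathcal M$ a finite collection of finite subsets (models) $m\subset\Lambda$. For $m\in\mathcal M$ put $G_m=(g_\lambda(t_j))_{1\le j\le p,\,\lambda\in m}$, $\Pi_m=G_m(G_m^\top G_m)^-G_m^\top$ (with $A^-$ a reflexive generalized inverse of $A$), $D_m=\mathrm{Tr}(\Pi_m\otimes\Pi_m)$, assumed positive, and $$\delta_m^2=\frac{\mathrm{Tr}((\Pi_m\otimes\Pi_m)\Phi)}{D_m},\quad \delta_m=\sqrt{\delta_m^2},\qquad C_{\inf}=\inf_{m\in\mathcal M}\mathrm{Tr}((\Pi_m\otimes\Pi_m)\Phi),\ \text{ assumed positive.}$$ Let $X_1,\dots,X_n$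 be independent copies of $X$, $x_i=(X_i(t_1),\dots,X_i(t_p))^\top$, $y_i=\mathrm{vec}(x_ix_i^\top)$, $S_{vec}=\frac1n\sum_{i=1}^n y_i$, and $$\widehat\Phi=\frac1n\sum_{i=1}^n\left(y_iy_i^\top-S_{vec}S_{vec}^\top\right),\qquad \widehat\delta_m^2=\frac{\mathrm{Tr}((\Pi_m\otimes\Pi_m)\widehat\Phi)}{D_m}.$$ **Proposition.** There are positive constants $C_1(\beta),C_2(\beta)$ depending only on $\beta$, and a threshold $n(\kappa,\beta,\alpha,C_{\inf},\Sigma)$ depending only on the displayed quantities, such that the following holds. Let $0<q\le 1$, $\beta>\max(2(1+2q),3+2q)$ with $\mathbb E\|xx^\top\|^\beta<\infty$, $\kappa\in\,]2(1+2q),\min(\beta,2\beta-4)[$, $\alpha\in\,]0,1[$, and put $\gamma=\kappa/4$. Then $\gamma\ge \frac{q}{1-2q/\kappa}$ and, for all $n\ge n(\kappa,\beta,\alpha,C_{\inf},\Sigma)$ and every $m\in\mathcal M$, $$\mathbb P\left(\widehat\delta_m^2\le(1-\alpha)\delta_m^2\right)\le\frac1{n^{\gamma}}\left(C_2(\beta)2^{\beta+1}+C_1(\beta)\frac1{\alpha^{\beta/2}}\right)\mathbb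 E\left[\|xx^\top\|^\beta\right]\delta_m^{-\beta}D_m^{-\beta/2}.$$ Consequently, for all such $n$, with $\Omega=\bigcap_{m\in\mathcal M}\{\widehat\delta_m^2\ge(1-\alpha)\delta_m^2\}$, $$\mathbb P(\Omega^c)\le\frac{\tilde C(\alpha)}{n^{\gamma}},\qquad \tilde C(\alpha)=\left(C_2(\beta)2^{\beta+1}+C_1(\beta)\frac1{\alpha^{\beta/2}}\right)\mathbb E\left[\|xx^\top\|^\beta\right]\sum_{m\in\mathcal M}\delta_m^{-\beta}D_m^{-\beta/2}.$$ -/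

import Mathlib

open MeasureTheory ProbabilityTheory
open scoped Kronecker Matrix

namespace CovSel

/-- Frobenius norm, `‖A‖² = Tr (A Aᵀ)`. -/
noncomputable def frob {k l : Type*} [Fintype k] [Fintype l] (A : Matrix k l ℝ) : ℝ :=
  Real.sqrt (A * Aᵀ).trace

/-- `B` is a reflexive generalized inverse of `A`. -/
def IsReflexiveInverse {k l : Type*} [Fintype k] [Fintype l]
    (A : Matrix k l ℝ) (B : Matrix l k ℝ) : Prop :=
  A * B * A = A ∧ B * A * B = B

theorem exists_isReflexiveInverse {k l : Type*} [Fintype k] [Fintype l]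
    (A : Matrix k l ℝ) : ∃ B : Matrix l k ℝ, IsReflexiveInverse A B := by
  classical
  let f := Matrix.toLin' A
  obtain ⟨s, hs⟩ := f.rangeRestrict.exists_rightInverse_of_surjective f.range_rangeRestrict
  obtain ⟨g, hg⟩ := LinearMap.exists_extend s
  have hfgf : f ∘ₗ g ∘ₗ f = f := by
    ext1 i
    ext1
    have h1 : g (f (LinearMap.single ℝ (fun _ => ℝ) i 1)) =
        s (f.rangeRestrict (LinearMap.single ℝ (fun _ => ℝ) i 1)) := by
      rw [← hg]; rfl
    have h2 := congrArg Subtype.val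
      (LinearMap.congr_fun hs (f.rangeRestrict (LinearMap.single ℝ (fun _ => ℝ) i 1)))
    simp only [LinearMap.comp_apply, h1]
    exact h2
  let C := LinearMap.toMatrix' g
  have hA : A * C * A = A := by
    have h := congrArg LinearMap.toMatrix' hfgf
    rw [LinearMap.toMatrix'_comp, LinearMap.toMatrix'_comp] at h
    simpa [f, C, Matrix.mul_assoc] using h
  refine ⟨C * A * C, ?_, ?_⟩
  · calc A * (C * A * C) * A = (A * C * A) * C * A := by simp only [Matrix.mul_assoc]
      _ = A := by rw [hA, hA]
  · calc C * A * C * A * (C * A * C) = C * (A * C * A) * C * A * C := by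
          simp only [Matrix.mul_assoc]
      _ = C * A * C * A * C := by rw [hA]
      _ = C * (A * C * A) * C := by simp only [Matrix.mul_assoc]
      _ = C * A * C := by rw [hA]

/-- A reflexive generalized inverse `A⁻` of `A`. -/
noncomputable def reflexiveInverse {k l : Type*} [Fintype k] [Fintype l]
    (A : Matrix k l ℝ) : Matrix l k ℝ :=
  (exists_isReflexiveInverse A).choose

theorem isReflexiveInverse_reflexiveInverse {k l : Type*} [Fintype k] [Fintype l]
    (A : Matrix k l ℝ) : IsReflexiveInverse A (reflexiveInverse A) :=
  (exists_isReflexiveInverse A).choose_spec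

section Models

variable {T Λ : Type*} {p : ℕ}

/-- The design matrix `G_m`, with entries `g_λ(t_j)`. -/
def design (g : Λ → T → ℝ) (t : Fin p → T) (m : Finset Λ) : Matrix (Fin p) m ℝ :=
  Matrix.of fun j l => g l (t j)

/-- `Π_m = G_m (G_mᵀ G_m)⁻ G_mᵀ`. -/
noncomputable def proj (g : Λ → T → ℝ) (t : Fin p → T) (m : Finset Λ) :
    Matrix (Fin p) (Fin p) ℝ :=
  design g t m * reflexiveInverse ((design g t m)ᵀ * design g t m) * (design g t m)ᵀ

/-- `D_m = Tr (Π_m ⊗ Π_m)`. -/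
noncomputable def dimM (g : Λ → T → ℝ) (t : Fin p → T) (m : Finset Λ) : ℝ :=
  (proj g t m ⊗ₖ proj g t m).trace

/-- `Tr ((Π_m ⊗ Π_m) Ψ)`. -/
noncomputable def projTrace (g : Λ → T → ℝ) (t : Fin p → T)
    (Ψ : Matrix (Fin p × Fin p) (Fin p × Fin p) ℝ) (m : Finset Λ) : ℝ :=
  ((proj g t m ⊗ₖ proj g t m) * Ψ).trace

end Models

section Population

variable {T Ω : Type*} [MeasurableSpace Ω] {p : ℕ}

/-- The vector `x = (X(t_1), …, X(t_p))` of values of a path at the observation points. -/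
def obs (t : Fin p → T) (path : T → ℝ) : Fin p → ℝ := fun j => path (t j)

/-- The matrix `x xᵀ`. -/
def obsSq (t : Fin p → T) (path : T → ℝ) : Matrix (Fin p) (Fin p) ℝ :=
  Matrix.vecMulVec (obs t path) (obs t path)

/-- The vector `y = vec (x xᵀ)`. -/
def obsVec (t : Fin p → T) (path : T → ℝ) : Fin p × Fin p → ℝ :=
  (obsSq t path).vec

/-- `Σ = E (x xᵀ)`. -/
noncomputable def sigmaMat (t : Fin p → T) (X : T → Ω → ℝ) (P : Measure Ω) :
    Matrix (Fin p) (Fin p) ℝ :=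
  Matrix.of fun j k => ∫ ω, obsSq t (fun s => X s ω) j k ∂P

/-- `Φ = V (vec (x xᵀ))`, the covariance matrix of `y`. -/
noncomputable def phiMat (t : Fin p → T) (X : T → Ω → ℝ) (P : Measure Ω) :
    Matrix (Fin p × Fin p) (Fin p × Fin p) ℝ :=
  Matrix.of fun a b =>
    covariance (fun ω => obsVec t (fun s => X s ω) a) (fun ω => obsVec t (fun s => X s ω) b) P

/-- `δ_m²`. -/
noncomputable def deltaSq {Λ : Type*} (g : Λ → T → ℝ) (t : Fin p → T) (X : T → Ω → ℝ)
    (P : Measure Ω) (m : Finset Λ) : ℝ :=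
  projTrace g t (phiMat t X P) m / dimM g t m

/-- `δ_m`. -/
noncomputable def delta {Λ : Type*} (g : Λ → T → ℝ) (t : Fin p → T) (X : T → Ω → ℝ)
    (P : Measure Ω) (m : Finset Λ) : ℝ :=
  Real.sqrt (deltaSq g t X P m)

/-- `C_inf = inf_{m ∈ M} Tr ((Π_m ⊗ Π_m) Φ)`. -/
noncomputable def cInf {Λ : Type*} (g : Λ → T → ℝ) (t : Fin p → T) (X : T → Ω → ℝ)
    (P : Measure Ω) (M : Finset (Finset Λ)) : ℝ :=
  ⨅ m : M, projTrace g t (phiMat t X P) m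

/-- `E ‖x xᵀ‖^β`. -/
noncomputable def normMoment (t : Fin p → T) (X : T → Ω → ℝ) (P : Measure Ω) (β : ℝ) : ℝ :=
  ∫ ω, frob (obsSq t (fun s => X s ω)) ^ β ∂P

end Population

section Empirical

variable {T : Type*} {p n : ℕ}

/-- `S_vec = n⁻¹ ∑ y_i`. -/
noncomputable def meanVec (t : Fin p → T) (paths : Fin n → T → ℝ) : Fin p × Fin p → ℝ :=
  (1 / (n : ℝ)) • ∑ i, obsVec t (paths i)

/-- `Φ̂ = n⁻¹ ∑ (y_i y_iᵀ - S_vec S_vecᵀ)`. -/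
noncomputable def phiHat (t : Fin p → T) (paths : Fin n → T → ℝ) :
    Matrix (Fin p × Fin p) (Fin p × Fin p) ℝ :=
  (1 / (n : ℝ)) • ∑ i, (Matrix.vecMulVec (obsVec t (paths i)) (obsVec t (paths i))
    - Matrix.vecMulVec (meanVec t paths) (meanVec t paths))

/-- `δ̂_m²`. -/
noncomputable def deltaHatSq {Λ : Type*} (g : Λ → T → ℝ) (t : Fin p → T)
    (paths : Fin n → T → ℝ) (m : Finset Λ) : ℝ :=
  projTrace g t (phiHat t paths) m / dimM g t m

end Empirical

end CovSel

open CovSel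

/-! Put `A = Π_m ⊗ Π_m`. It is an orthogonal projection, so the pair form `h(y, y') = (y - y')ᵀ A (y
- y') / 2` is nonnegative and vanishes on the diagonal. Its mean over independent copies is `τ = Tr
(A Φ)`, while `Tr (A Φ̂)` is the average of `h` over all `n²` index pairs. Up to the factor `(n - 1)
/ n`, which costs half of `α` once `n ≥ 2 / α`, the claim is a lower-tail bound for a nonnegative
U-statistic of order two.

Nonnegativity makes the lower tail cheap. Hoeffding's averaging over permutations
(`exp_neg_pair_average_le`) replaces the U-statistic by `k = ⌊n / 2⌋` independent pairs. The
inequality `exp (-u) ≤ 1 - u + u ^ r`, `1 ≤ r ≤ 2`, bounds the Laplace transform using only `w = E h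
^ r`. Chernoff's bound, then `exp (-v) ≤ s ^ s * v ^ (-s)` with `s = b - b / r`, gives order `k ^
(-s)` times `τ ^ (-b) * E h ^ b` (`measureReal_pair_average_le`).

Take `b = β / 2` and `r = min (β / 2) 2`. Then `s ≥ κ / 4`, `E h ^ b` is controlled by `E ‖xxᵀ‖ ^
β`, and `τ = δ_m² D_m` turns `τ ^ (-b)` into the stated factor. A union bound over the models
finishes. -/

namespace CovSel

/-! ### Scalar inequalities for the exponential -/

/-- On `[0, 1]` the second-order bound suffices because `u ^ 2 ≤ u ^ r`; beyond `1` the right side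
is at least `1`. An exponent `r < 2` serves the case where `h` has no second moment. -/
theorem exp_neg_le_one_sub_add_rpow {u r : ℝ} (hu : 0 ≤ u) (hr : 1 ≤ r) (hr2 : r ≤ 2) :
    Real.exp (-u) ≤ 1 - u + u ^ r := by
  rcases le_total u 1 with h | h
  · have h1 : u ^ (2 : ℝ) ≤ u ^ r := by
      rcases hu.eq_or_lt with rfl | hu
      · rw [Real.zero_rpow (by norm_num), Real.zero_rpow (by linarith)]
      · exact Real.rpow_le_rpow_of_exponent_ge hu h hr2
    rw [Real.rpow_two] at h1
    have h3 : |Real.exp (-u) - 1 - -u| ≤ (-u) ^ 2 :=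
      Real.abs_exp_sub_one_sub_id_le (by rwa [abs_neg, abs_of_nonneg hu])
    have := (abs_le.1 h3).2
    nlinarith
  · have h1 : u ≤ u ^ r := by
      simpa using Real.rpow_le_rpow_of_exponent_le h hr
    have := Real.exp_le_one_iff.2 (neg_nonpos.2 hu)
    linarith

/-- Raise `v / s ≤ exp (v / s)` to the power `s`. -/
theorem exp_neg_le_rpow_mul_rpow_neg {v s : ℝ} (hv : 0 < v) (hs : 0 < s) :
    Real.exp (-v) ≤ s ^ s * v ^ (-s) := by
  have h1 : v / s ≤ Real.exp (v / s) := (by linarith [Real.add_one_le_exp (v / s)])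
  have h2 : (v / s) ^ s ≤ Real.exp v := by
    calc (v / s) ^ s ≤ Real.exp (v / s) ^ s := Real.rpow_le_rpow (by positivity) h1 hs.le
      _ = Real.exp v := by rw [← Real.exp_mul, div_mul_cancel₀ _ hs.ne']
  rw [Real.div_rpow hv.le hs.le, div_le_iff₀ (by positivity)] at h2
  rw [Real.exp_neg, Real.rpow_neg hv.le, ← div_eq_mul_inv, le_div_iff₀ (by positivity),
    inv_mul_le_iff₀ (Real.exp_pos v)]
  exact h2

/-! ### Hoeffding's averaging over permutations -/

/-- One swap carries `a` to `c`; a second moves the image of `b` to `d` and fixes `c`. -/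
theorem exists_perm_map_pair {ι : Type*} [DecidableEq ι] {a b c d : ι} (hab : a ≠ b) (hcd : c ≠ d) :
    ∃ π : Equiv.Perm ι, π a = c ∧ π b = d := by
  refine ⟨Equiv.swap (Equiv.swap a c b) d * Equiv.swap a c, ?_, ?_⟩
  · rw [Equiv.Perm.mul_apply, Equiv.swap_apply_left]
    refine Equiv.swap_apply_of_ne_of_ne (fun h => hab ?_) hcd
    have := congrArg (Equiv.swap a c) h
    simpa using this
  · simp

section Permutations

variable {ι : Type*} [Fintype ι] [DecidableEq ι]

theorem sum_perm_pair_eq {F : ι → ι → ℝ} {a b c d : ι} (hab : a ≠ b) (hcd : c ≠ d) :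
    ∑ σ : Equiv.Perm ι, F (σ c) (σ d) = ∑ σ : Equiv.Perm ι, F (σ a) (σ b) := by
  obtain ⟨π, rfl, rfl⟩ := exists_perm_map_pair hab hcd
  exact Equiv.sum_comp (Equiv.mulRight π) fun σ : Equiv.Perm ι => F (σ a) (σ b)

/-- Averaging over all permutations turns one off-diagonal entry into the mean of all of them. -/
theorem card_mul_sum_perm_pair {F : ι → ι → ℝ} (hF : ∀ i, F i i = 0) {a b : ι} (hab : a ≠ b) :
    ((Fintype.card ι : ℝ) * (Fintype.card ι - 1)) * ∑ σ : Equiv.Perm ι, F (σ a) (σ b) =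
      (Fintype.card (Equiv.Perm ι) : ℝ) * ∑ i, ∑ j, F i j := by
  have h1 : ∀ σ : Equiv.Perm ι, ∑ c, ∑ d, F (σ c) (σ d) = ∑ i, ∑ j, F i j := fun σ => by
    rw [← Equiv.sum_comp σ fun i => ∑ j, F i j]
    exact Finset.sum_congr rfl fun c _ => Equiv.sum_comp σ fun j => F (σ c) j
  have h2 : ∑ σ : Equiv.Perm ι, ∑ c, ∑ d, F (σ c) (σ d) =
      (Fintype.card (Equiv.Perm ι) : ℝ) * ∑ i, ∑ j, F i j := by
    simp [h1]
  rw [← h2, Finset.sum_comm]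
  -- For fixed `c` the diagonal term vanishes and the other `card ι - 1` terms all agree.
  have h3 : ∀ c, ∑ σ : Equiv.Perm ι, ∑ d, F (σ c) (σ d) =
      ((Fintype.card ι : ℝ) - 1) * ∑ σ : Equiv.Perm ι, F (σ a) (σ b) := fun c => by
    rw [Finset.sum_comm, ← Finset.add_sum_erase _ _ (Finset.mem_univ c)]
    rw [Finset.sum_congr rfl fun d hd => sum_perm_pair_eq hab (Finset.ne_of_mem_erase hd).symm]
    have : 1 ≤ Fintype.card ι := Fintype.card_pos_iff.2 ⟨a⟩
    simp [hF, Finset.card_erase_of_mem, Nat.cast_sub this]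
  simp [h3, mul_assoc]

/-- Hoeffding's device: an exponential of a complete pair average is at most the average of the
exponentials of the sums over disjoint pairs. -/
theorem exp_neg_pair_average_le {F : ι → ι → ℝ} (hF : ∀ i, F i i = 0)
    {k : ℕ} {u v : Fin k → ι} (huv : ∀ j, u j ≠ v j) (hι : 2 ≤ Fintype.card ι) :
    Real.exp (-(k * ((∑ i, ∑ j, F i j) / ((Fintype.card ι : ℝ) * (Fintype.card ι - 1))))) ≤
      ∑ σ : Equiv.Perm ι, (Fintype.card (Equiv.Perm ι) : ℝ)⁻¹ *
        Real.exp (-∑ j, F (σ (u j)) (σ (v j))) := by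
  have hn : (2 : ℝ) ≤ Fintype.card ι := by exact_mod_cast hι
  have hP : (0 : ℝ) < Fintype.card (Equiv.Perm ι) := by exact_mod_cast Fintype.card_pos
  have hD : (Fintype.card ι : ℝ) * (Fintype.card ι - 1) ≠ 0 := by
    have : (0 : ℝ) < (Fintype.card ι : ℝ) - 1 := by linarith
    positivity
  have h1 : ∀ j, ∑ σ : Equiv.Perm ι, F (σ (u j)) (σ (v j)) =
      (Fintype.card (Equiv.Perm ι) : ℝ) *
        ((∑ i, ∑ j, F i j) / ((Fintype.card ι : ℝ) * (Fintype.card ι - 1))) := fun j => by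
    rw [← mul_div_assoc, eq_div_iff hD, mul_comm, card_mul_sum_perm_pair hF (huv j)]
  -- Jensen's inequality with uniform weights on the permutations.
  have key := convexOn_exp.map_sum_le (t := (Finset.univ : Finset (Equiv.Perm ι)))
    (w := fun _ => (Fintype.card (Equiv.Perm ι) : ℝ)⁻¹)
    (p := fun σ => -∑ j, F (σ (u j)) (σ (v j)))
    (fun _ _ => by positivity) (by simp [hP.ne']) (fun _ _ => Set.mem_univ _)
  simp only [smul_eq_mul] at key
  refine le_trans (le_of_eq ?_) key
  congr 1
  have h2 : ∑ σ : Equiv.Perm ι, ∑ j, F (σ (u j)) (σ (v j)) =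
      k * ((Fintype.card (Equiv.Perm ι) : ℝ) *
        ((∑ i, ∑ j, F i j) / ((Fintype.card ι : ℝ) * (Fintype.card ι - 1)))) := by
    rw [Finset.sum_comm, Finset.sum_congr rfl fun j _ => h1 j]
    simp
  rw [← Finset.mul_sum, Finset.sum_neg_distrib, h2]
  field_simp

end Permutations

/-! ### Disjoint pairs of independent variables -/

section Independence

variable {Ω E ι : Type*} [MeasurableSpace Ω] [MeasurableSpace E] {Q : Measure Ω} {μ : Measure E}
  [IsProbabilityMeasure μ]

/-- Injectivity of `Sum.elim u v` says that the pairs use distinct indices, so the joint law is a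
product; the rest regroups coordinates. -/
theorem map_pairs_eq_pi {κ : Type*} [Fintype κ] {Y : ι → Ω → E} (hY : iIndepFun Y Q)
    (hm : ∀ i, AEMeasurable (Y i) Q) (hlaw : ∀ i, Q.map (Y i) = μ) {u v : κ → ι}
    (huv : Function.Injective (Sum.elim u v)) :
    Q.map (fun ω j => (Y (u j) ω, Y (v j) ω)) = Measure.pi fun _ : κ => μ.prod μ := by
  have h1 := (hY.precomp huv).map_fun_eq_pi_map (fun i => hm _)
  simp only [hlaw] at h1
  have h2 := (measurePreserving_sumPiEquivProdPi (fun _ : κ ⊕ κ => μ)).map_eq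
  have h3 := (measurePreserving_arrowProdEquivProdArrow E E κ (fun _ => μ) (fun _ => μ)).symm.map_eq
  rw [← h3, ← h2, ← h1]
  have hZ : AEMeasurable (fun ω i => Y (Sum.elim u v i) ω) Q := aemeasurable_pi_lambda _ fun i => hm _
  rw [AEMeasurable.map_map_of_aemeasurable (MeasurableEquiv.measurable _).aemeasurable hZ,
    AEMeasurable.map_map_of_aemeasurable (MeasurableEquiv.measurable _).aemeasurable
      ((MeasurableEquiv.measurable _).comp_aemeasurable hZ)]
  rfl

theorem integral_prod_pairs {k : ℕ} {Y : ι → Ω → E} (hY : iIndepFun Y Q)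
    (hm : ∀ i, AEMeasurable (Y i) Q) (hlaw : ∀ i, Q.map (Y i) = μ) {u v : Fin k → ι}
    (huv : Function.Injective (Sum.elim u v)) {f : E × E → ℝ} (hf : Measurable f) :
    ∫ ω, ∏ j, f (Y (u j) ω, Y (v j) ω) ∂Q = (∫ z, f z ∂μ.prod μ) ^ k := by
  have h1 := map_pairs_eq_pi hY hm hlaw huv
  have h2 := integral_fintype_prod_eq_pow (ι := Fin k) f (μ := μ.prod μ)
  have hf' : Measurable fun x : Fin k → E × E => ∏ j, f (x j) :=
    Finset.univ.measurable_fun_prod fun j _ => hf.comp (measurable_pi_apply j)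
  rw [← h1, integral_map (aemeasurable_pi_lambda _ fun j => (hm _).prodMk (hm _))
    hf'.aestronglyMeasurable, Fintype.card_fin] at h2
  exact h2

theorem integral_exp_neg_pair_average_le [Fintype ι] [DecidableEq ι] [IsProbabilityMeasure Q]
    {k : ℕ} {Y : ι → Ω → E} (hY : iIndepFun Y Q) (hm : ∀ i, AEMeasurable (Y i) Q)
    (hlaw : ∀ i, Q.map (Y i) = μ) {u v : Fin k → ι} (huv : Function.Injective (Sum.elim u v))
    (hι : 2 ≤ Fintype.card ι) {h : E × E → ℝ} (hh : Measurable h) (h0 : ∀ z, 0 ≤ h z)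
    (hd : ∀ x, h (x, x) = 0) :
    ∫ ω, Real.exp (-(k * ((∑ i, ∑ j, h (Y i ω, Y j ω)) /
        ((Fintype.card ι : ℝ) * (Fintype.card ι - 1))))) ∂Q ≤
      (∫ z, Real.exp (-h z) ∂μ.prod μ) ^ k := by
  have hne : ∀ j, u j ≠ v j := fun j e => by
    have := @huv (Sum.inl j) (Sum.inr j) e
    simp at this
  have hYm : ∀ i j, AEMeasurable (fun ω => h (Y i ω, Y j ω)) Q := fun i j =>
    hh.comp_aemeasurable ((hm i).prodMk (hm j))
  have hint : ∀ σ : Equiv.Perm ι, Integrable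
      (fun ω => Real.exp (-∑ j, h (Y (σ (u j)) ω, Y (σ (v j)) ω))) Q := fun σ => by
    refine Integrable.of_bound (C := 1) ?_ (ae_of_all _ fun ω => ?_)
    · exact (Real.measurable_exp.comp_aemeasurable
        (Finset.univ.aemeasurable_fun_sum fun j _ => hYm _ _).neg).aestronglyMeasurable
    · rw [Real.norm_eq_abs, abs_of_pos (Real.exp_pos _), Real.exp_le_one_iff, neg_nonpos]
      exact Finset.sum_nonneg fun j _ => h0 _
  -- Permuting the indices keeps them distinct, so every term of the average has the same
  -- expectation.
  have hσ : ∀ σ : Equiv.Perm ι, ∫ ω, Real.exp (-∑ j, h (Y (σ (u j)) ω, Y (σ (v j)) ω)) ∂Q =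
      (∫ z, Real.exp (-h z) ∂μ.prod μ) ^ k := fun σ => by
    have hinj : Function.Injective (Sum.elim (fun j => σ (u j)) fun j => σ (v j)) := by
      have : Sum.elim (fun j => σ (u j)) (fun j => σ (v j)) = σ ∘ Sum.elim u v := by
        rw [Sum.comp_elim]; rfl
      rw [this]; exact σ.injective.comp huv
    rw [← integral_prod_pairs hY hm hlaw hinj (f := fun z => Real.exp (-h z)) (by fun_prop)]
    simp only [← Finset.sum_neg_distrib, Real.exp_sum]
  have hP : (Fintype.card (Equiv.Perm ι) : ℝ) ≠ 0 := by exact_mod_cast Fintype.card_ne_zero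
  calc _ ≤ ∫ ω, ∑ σ : Equiv.Perm ι, (Fintype.card (Equiv.Perm ι) : ℝ)⁻¹ *
        Real.exp (-∑ j, h (Y (σ (u j)) ω, Y (σ (v j)) ω)) ∂Q := by
        refine integral_mono_of_nonneg (ae_of_all _ fun ω => (Real.exp_pos _).le)
          (integrable_finsetSum _ fun σ _ => (hint σ).const_mul _) (ae_of_all _ fun ω => ?_)
        exact exp_neg_pair_average_le (F := fun i j => h (Y i ω, Y j ω)) (fun i => hd _) hne hι
    _ = _ := by
        rw [integral_finsetSum _ fun σ _ => (hint σ).const_mul _]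
        simp only [integral_const_mul, hσ, Finset.sum_const, Finset.card_univ, nsmul_eq_mul]
        rw [← mul_assoc, mul_inv_cancel₀ hP, one_mul]

end Independence

/-! ### Moments and Laplace transforms of nonnegative variables -/

section Moments

variable {α : Type*} [MeasurableSpace α] {ν : Measure α} [IsProbabilityMeasure ν]

theorem integrable_rpow_of_le {f : α → ℝ} (hf : AEStronglyMeasurable f ν) (h0 : ∀ x, 0 ≤ f x)
    {r b : ℝ} (hr : 0 ≤ r) (hrb : r ≤ b) (hb : Integrable (fun x => f x ^ b) ν) :
    Integrable (fun x => f x ^ r) ν := by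
  refine ((integrable_const (1 : ℝ)).add hb).mono'
    (hf.aemeasurable.pow_const r).aestronglyMeasurable (ae_of_all _ fun x => ?_)
  rw [Real.norm_eq_abs, abs_of_nonneg (Real.rpow_nonneg (h0 x) _), Pi.add_apply]
  rcases le_total (f x) 1 with h | h
  · linarith [Real.rpow_le_one (h0 x) h hr, Real.rpow_nonneg (h0 x) b]
  · linarith [Real.rpow_le_rpow_of_exponent_le h hrb]

theorem rpow_integral_le {f : α → ℝ} (h0 : ∀ x, 0 ≤ f x) {p : ℝ} (hp : 1 ≤ p)
    (hf : Integrable f ν) (hfp : Integrable (fun x => f x ^ p) ν) :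
    (∫ x, f x ∂ν) ^ p ≤ ∫ x, f x ^ p ∂ν :=
  (convexOn_rpow hp).map_integral_le 
    (continuousOn_id.rpow_const fun _ _ => Or.inr (by linarith)) isClosed_Ici
    (ae_of_all _ h0) hf hfp

theorem integral_exp_neg_mul_le {f : α → ℝ} (hf : AEStronglyMeasurable f ν) (h0 : ∀ x, 0 ≤ f x)
    {r : ℝ} (hr : 1 ≤ r) (hr2 : r ≤ 2) (hfr : Integrable (fun x => f x ^ r) ν) {l : ℝ}
    (hl : 0 ≤ l) :
    ∫ x, Real.exp (-(l * f x)) ∂ν ≤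
      Real.exp (-(l * ∫ x, f x ∂ν) + l ^ r * ∫ x, f x ^ r ∂ν) := by
  have hf1 : Integrable f ν := by
    simpa using integrable_rpow_of_le hf h0 zero_le_one hr hfr
  calc _ ≤ ∫ x, (1 - l * f x) + l ^ r * f x ^ r ∂ν := by
        refine integral_mono_of_nonneg (ae_of_all _ fun ω => (Real.exp_pos _).le)
          (((integrable_const _).sub (hf1.const_mul _)).add (hfr.const_mul _))
          (ae_of_all _ fun x => ?_)
        have := exp_neg_le_one_sub_add_rpow (mul_nonneg hl (h0 x)) hr hr2
        rwa [Real.mul_rpow hl (h0 x)] at this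
    _ = (-(l * ∫ x, f x ∂ν) + l ^ r * ∫ x, f x ^ r ∂ν) + 1 := by
        have hI : Integrable (fun x => 1 - l * f x) ν := (integrable_const _).sub (hf1.const_mul _)
        rw [integral_add hI (hfr.const_mul _),
          integral_sub (integrable_const _) (hf1.const_mul _), integral_const_mul,
          integral_const_mul]
        simp
        ring
    _ ≤ _ := Real.add_one_le_exp _

end Moments

/-- The Chernoff exponent after optimisation over the dual parameter. -/
theorem exists_dual_parameter {θ w r : ℝ} (hθ : 0 < θ) (hw : 0 < w) (hr : 1 < r) :
    ∃ l, 0 < l ∧ l ^ r * w = l * θ ∧ ∀ b, (l * θ) ^ (-(b - b / r)) = θ ^ (-b) * w ^ (b / r) := by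
  have hr1 : r - 1 ≠ 0 := by linarith
  have hr0 : r ≠ 0 := by linarith
  -- The solution of `l ^ (r - 1) = θ / w`.
  refine ⟨(θ / w) ^ (1 / (r - 1)), by positivity, ?_, fun b => ?_⟩
  · have h1 : ((θ / w) ^ (1 / (r - 1))) ^ (r - 1) = θ / w := by
      rw [← Real.rpow_mul (by positivity), one_div_mul_cancel hr1, Real.rpow_one]
    have h2 : ((θ / w) ^ (1 / (r - 1))) ^ r =
        ((θ / w) ^ (1 / (r - 1))) ^ (r - 1) * (θ / w) ^ (1 / (r - 1)) := by
      rw [← Real.rpow_add_one (by positivity), sub_add_cancel]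
    rw [h2, h1]
    field_simp
  · apply Real.log_injOn_pos (Set.mem_Ioi.2 (by positivity)) (Set.mem_Ioi.2 (by positivity))
    rw [Real.log_rpow (by positivity), Real.log_mul (by positivity) hθ.ne',
      Real.log_rpow (by positivity), Real.log_div hθ.ne' hw.ne', Real.log_mul (by positivity)
      (by positivity), Real.log_rpow hθ, Real.log_rpow hw]
    field_simp
    ring

/-! ### Lower tail of a nonnegative U-statistic -/

section TailBound

variable {Ω E ι : Type*} [MeasurableSpace Ω] [MeasurableSpace E] {Q : Measure Ω} {μ : Measure E}
  [IsProbabilityMeasure μ]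

/-- Lower tail of a nonnegative U-statistic of order two, polynomial form. -/
theorem measureReal_pair_average_le [Fintype ι] [DecidableEq ι] [IsProbabilityMeasure Q]
    {k : ℕ} {Y : ι → Ω → E} (hY : iIndepFun Y Q) (hm : ∀ i, AEMeasurable (Y i) Q)
    (hlaw : ∀ i, Q.map (Y i) = μ) (hk : 0 < k) (hι : 2 * k ≤ Fintype.card ι)
    {h : E × E → ℝ} (hh : Measurable h) (h0 : ∀ z, 0 ≤ h z) (hd : ∀ x, h (x, x) = 0)
    {r b a : ℝ} (hr : 1 < r) (hr2 : r ≤ 2) (hrb : r ≤ b) (ha : 0 < a)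
    (hb : Integrable (fun z => h z ^ b) (μ.prod μ)) (hτ : 0 < ∫ z, h z ∂μ.prod μ) :
    Q.real {ω | (∑ i, ∑ j, h (Y i ω, Y j ω)) / ((Fintype.card ι : ℝ) * (Fintype.card ι - 1)) ≤
        (1 - a) * ∫ z, h z ∂μ.prod μ} ≤
      (b - b / r) ^ (b - b / r) * (k : ℝ) ^ (-(b - b / r)) *
        ((a * (∫ z, h z ∂μ.prod μ) / 2) ^ (-b) * ∫ z, h z ^ b ∂μ.prod μ) := by
  have hh' : AEStronglyMeasurable h (μ.prod μ) := hh.aestronglyMeasurable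
  have hIr := integrable_rpow_of_le hh' h0 (by linarith) hrb hb
  have hI1 : Integrable h (μ.prod μ) := by
    simpa using integrable_rpow_of_le hh' h0 zero_le_one hr.le hIr
  have hw : 0 < ∫ z, h z ^ r ∂μ.prod μ :=
    lt_of_lt_of_le (by positivity) (rpow_integral_le h0 hr.le hI1 hIr)
  -- Jensen's inequality with the exponent `b / r ≥ 1`.
  have hwb : (∫ z, h z ^ r ∂μ.prod μ) ^ (b / r) ≤ ∫ z, h z ^ b ∂μ.prod μ := by
    have hrw : ∀ z, (h z ^ r) ^ (b / r) = h z ^ b := fun z => by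
      rw [← Real.rpow_mul (h0 z), mul_div_cancel₀ _ (by linarith)]
    have := rpow_integral_le (ν := μ.prod μ) (f := fun z => h z ^ r) (p := b / r)
      (fun z => Real.rpow_nonneg (h0 z) _) ((one_le_div (by linarith)).2 hrb) hIr (by simpa [hrw])
    simpa [hrw] using this
  set τ := ∫ z, h z ∂μ.prod μ
  set w := ∫ z, h z ^ r ∂μ.prod μ
  have hs : 0 < b - b / r := by
    have : b / r < b := div_lt_self (by linarith) hr
    linarith
  -- With `θ = a τ / 2`, the error `l ^ r * w` consumes exactly half of the Chernoff gain `l * a *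
  -- τ`.
  obtain ⟨l, hl, hl1, hl2⟩ := exists_dual_parameter (θ := a * τ / 2) (by positivity) hw hr
  obtain ⟨e⟩ : Nonempty (Fin k ⊕ Fin k ↪ ι) :=
    Function.Embedding.nonempty_of_card_le (by simpa [two_mul] using hι)
  have huv : Function.Injective (Sum.elim (fun j => e (Sum.inl j)) fun j => e (Sum.inr j)) := by
    have : Sum.elim (fun j => e (Sum.inl j)) (fun j => e (Sum.inr j)) = e := by
      ext (j | j) <;> rfl
    rw [this]; exact e.injective
  set U : Ω → ℝ := fun ω =>
    (∑ i, ∑ j, h (Y i ω, Y j ω)) / ((Fintype.card ι : ℝ) * (Fintype.card ι - 1)) with hU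
  have hn : (2 : ℝ) ≤ Fintype.card ι := by exact_mod_cast (by omega : 2 ≤ Fintype.card ι)
  have hU0 : ∀ ω, 0 ≤ U ω := fun ω =>
    div_nonneg (Finset.sum_nonneg fun i _ => Finset.sum_nonneg fun j _ => h0 _)
      (mul_nonneg (by linarith) (by linarith))
  have hUm : AEMeasurable U Q := by
    refine AEMeasurable.div_const ?_ _
    exact Finset.univ.aemeasurable_fun_sum fun i _ => Finset.univ.aemeasurable_fun_sum fun j _ =>
      hh.comp_aemeasurable ((hm i).prodMk (hm j))
  have hexpU : ∫ ω, Real.exp (-(k * (l * U ω))) ∂Q ≤ Real.exp (-(l * τ) + l ^ r * w) ^ k := by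
    have h1 := integral_exp_neg_pair_average_le hY hm hlaw huv (by omega)
      (h := fun z => l * h z) (hh.const_mul l) (fun z => mul_nonneg hl.le (h0 z))
      (fun x => by rw [hd, mul_zero])
    have h2 := integral_exp_neg_mul_le hh' h0 hr.le hr2 hIr hl.le
    refine le_trans (le_of_eq ?_)
      (h1.trans (pow_le_pow_left₀ (integral_nonneg fun z => (Real.exp_pos _).le) h2 k))
    simp only [hU, ← Finset.mul_sum, mul_div_assoc]
  have hint : Integrable (fun ω => Real.exp (-(k * l) * U ω)) Q := by
    refine Integrable.of_bound (C := 1) (by fun_prop) (ae_of_all _ fun ω => ?_)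
    rw [Real.norm_eq_abs, abs_of_pos (Real.exp_pos _), Real.exp_le_one_iff, neg_mul, neg_nonpos]
    exact mul_nonneg (by positivity) (hU0 ω)
  have hch := measure_le_le_exp_mul_mgf (μ := Q) (X := U) (t := -(k * l)) ((1 - a) * τ)
    (by simp only [neg_nonpos]; positivity) hint
  have hkθ : 0 < k * (l * (a * τ / 2)) := by positivity
  calc Q.real {ω | U ω ≤ (1 - a) * τ}
      ≤ Real.exp (-(-(k * l)) * ((1 - a) * τ)) * mgf U Q (-(k * l)) := hch
    _ ≤ Real.exp (-(-(k * l)) * ((1 - a) * τ)) * Real.exp (-(l * τ) + l ^ r * w) ^ k := by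
        refine mul_le_mul_of_nonneg_left (le_trans (le_of_eq ?_) hexpU) (Real.exp_pos _).le
        simp only [mgf, neg_mul, mul_assoc]
    _ = Real.exp (-(k * (l * (a * τ / 2)))) := by
        rw [← Real.exp_nat_mul, ← Real.exp_add, hl1]
        congr 1
        ring
    _ ≤ (b - b / r) ^ (b - b / r) * (k * (l * (a * τ / 2))) ^ (-(b - b / r)) :=
        exp_neg_le_rpow_mul_rpow_neg hkθ hs
    _ = (b - b / r) ^ (b - b / r) * (k : ℝ) ^ (-(b - b / r)) *
        ((a * τ / 2) ^ (-b) * w ^ (b / r)) := by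
        rw [Real.mul_rpow (by positivity) (by positivity), hl2, mul_assoc]
    _ ≤ _ := by gcongr

end TailBound

/-! ### Orthogonal projections from generalized inverses -/

section Projection

variable {k l : Type*} [Fintype k] [Fintype l]

/-- The difference `M` of the two sides satisfies `Gᵀ M = 0` and has the form `G N`, so `Mᵀ M = 0`.
-/
theorem mul_generalizedInverse_mul_gram {G : Matrix k l ℝ} {B : Matrix l l ℝ}
    (hB : Gᵀ * G * B * (Gᵀ * G) = Gᵀ * G) : G * B * (Gᵀ * G) = G := by
  classical
  have h1 : (G * B * (Gᵀ * G) - G)ᴴ * (G * B * (Gᵀ * G) - G) = 0 := by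
    have h2 : Gᵀ * (G * B * (Gᵀ * G) - G) = 0 := by
      rw [Matrix.mul_sub, sub_eq_zero]
      simpa only [Matrix.mul_assoc] using hB
    have h3 : (G * B * (Gᵀ * G) - G)ᵀ = (B * (Gᵀ * G) - 1)ᵀ * Gᵀ := by
      rw [← Matrix.transpose_mul, Matrix.mul_sub, Matrix.mul_one, Matrix.mul_assoc]
    rw [Matrix.conjTranspose_eq_transpose_of_trivial, h3, Matrix.mul_assoc, h2, Matrix.mul_zero]
  exact sub_eq_zero.1 (Matrix.conjTranspose_mul_self_eq_zero.1 h1)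

/-- `G (GᵀG)⁻ Gᵀ` is an orthogonal projection. -/
theorem gramProjection_transpose_and_sq {G : Matrix k l ℝ} {B : Matrix l l ℝ}
    (hB : Gᵀ * G * B * (Gᵀ * G) = Gᵀ * G) :
    (G * B * Gᵀ)ᵀ = G * B * Gᵀ ∧ G * B * Gᵀ * (G * B * Gᵀ) = G * B * Gᵀ := by
  -- The inverse `B` need not be symmetric, but `Bᵀ` is again a generalized inverse of the symmetric
  -- matrix `Gᵀ * G`.
  have hBt : Gᵀ * G * Bᵀ * (Gᵀ * G) = Gᵀ * G := by
    have := congrArg Matrix.transpose hB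
    simpa only [Matrix.transpose_mul, Matrix.transpose_transpose, Matrix.mul_assoc] using this
  have h1 := mul_generalizedInverse_mul_gram hB
  have h2 : Gᵀ * (G * B * Gᵀ) = Gᵀ := by
    have := congrArg Matrix.transpose (mul_generalizedInverse_mul_gram hBt)
    simpa only [Matrix.transpose_mul, Matrix.transpose_transpose, Matrix.mul_assoc] using this
  have h3 : (G * B * Gᵀ)ᵀ * (G * B * Gᵀ) = (G * B * Gᵀ)ᵀ := by
    have : (G * B * Gᵀ)ᵀ = G * Bᵀ * Gᵀ := by
      simp only [Matrix.transpose_mul, Matrix.transpose_transpose, Matrix.mul_assoc]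
    rw [this, Matrix.mul_assoc, h2]
  have h4 : (G * B * Gᵀ)ᵀ * (G * B * Gᵀ) = G * B * Gᵀ := by
    have := congrArg Matrix.transpose h3
    rwa [Matrix.transpose_mul, Matrix.transpose_transpose] at this
  refine ⟨h3.symm.trans h4, ?_⟩
  calc G * B * Gᵀ * (G * B * Gᵀ) = G * B * (Gᵀ * G) * B * Gᵀ := by simp only [Matrix.mul_assoc]
    _ = G * B * Gᵀ := by rw [h1]

theorem proj_transpose_and_sq {T Λ : Type*} {p : ℕ} (g : Λ → T → ℝ) (t : Fin p → T)
    (m : Finset Λ) :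
    (proj g t m)ᵀ = proj g t m ∧ proj g t m * proj g t m = proj g t m :=
  gramProjection_transpose_and_sq (isReflexiveInverse_reflexiveInverse _).1

theorem proj_kronecker_transpose_and_sq {T Λ : Type*} {p : ℕ} (g : Λ → T → ℝ) (t : Fin p → T)
    (m : Finset Λ) :
    (proj g t m ⊗ₖ proj g t m)ᵀ = proj g t m ⊗ₖ proj g t m ∧
      (proj g t m ⊗ₖ proj g t m) * (proj g t m ⊗ₖ proj g t m) = proj g t m ⊗ₖ proj g t m := by
  obtain ⟨h1, h2⟩ := proj_transpose_and_sq g t m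
  constructor
  · rw [← Matrix.kroneckerMap_transpose, h1]
  · rw [← Matrix.mul_kronecker_mul, h2]

end Projection

/-! ### The pair form: empirical trace, mean and moments -/

section PairForm

variable {ι : Type*} [Fintype ι]

/-- Half the quadratic form of a difference. -/
noncomputable def pairForm (A : Matrix ι ι ℝ) (z : (ι → ℝ) × (ι → ℝ)) : ℝ :=
  ((z.1 - z.2) ⬝ᵥ A *ᵥ (z.1 - z.2)) / 2

theorem pairForm_eq_sum (A : Matrix ι ι ℝ) (z : (ι → ℝ) × (ι → ℝ)) :
    pairForm A z = ∑ a, ∑ b, A a b / 2 * ((z.1 a - z.2 a) * (z.1 b - z.2 b)) := by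
  simp only [pairForm, dotProduct, Matrix.mulVec, Finset.mul_sum, Finset.sum_div, Pi.sub_apply]
  exact Finset.sum_congr rfl fun a _ => Finset.sum_congr rfl fun b _ => by ring

theorem measurable_pairForm (A : Matrix ι ι ℝ) : Measurable (pairForm A) := by
  simp only [funext (pairForm_eq_sum A)]
  fun_prop

theorem pairForm_self (A : Matrix ι ι ℝ) (x : ι → ℝ) : pairForm A (x, x) = 0 := by
  simp [pairForm]

theorem dotProduct_mulVec_eq_of_projection {A : Matrix ι ι ℝ} (hs : Aᵀ = A) (hi : A * A = A)
    (v : ι → ℝ) : v ⬝ᵥ A *ᵥ v = A *ᵥ v ⬝ᵥ A *ᵥ v := by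
  rw [Matrix.dotProduct_mulVec (A *ᵥ v), ← Matrix.mulVec_transpose, hs, Matrix.mulVec_mulVec, hi,
    dotProduct_comm]

theorem pairForm_nonneg {A : Matrix ι ι ℝ} (hs : Aᵀ = A) (hi : A * A = A)
    (z : (ι → ℝ) × (ι → ℝ)) : 0 ≤ pairForm A z := by
  rw [pairForm, dotProduct_mulVec_eq_of_projection hs hi]
  exact div_nonneg (Finset.sum_nonneg fun i _ => mul_self_nonneg _) zero_le_two

/-- A projection does not increase length, and the parallelogram law gives `|y - y'|² ≤ 2 (|y|² +
|y'|²)`. -/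
theorem pairForm_le {A : Matrix ι ι ℝ} (hs : Aᵀ = A) (hi : A * A = A)
    (z : (ι → ℝ) × (ι → ℝ)) : pairForm A z ≤ z.1 ⬝ᵥ z.1 + z.2 ⬝ᵥ z.2 := by
  set v := z.1 - z.2 with hv
  have h1 : 0 ≤ (v - A *ᵥ v) ⬝ᵥ (v - A *ᵥ v) := Finset.sum_nonneg fun i _ => mul_self_nonneg _
  have h2 : 0 ≤ (z.1 + z.2) ⬝ᵥ (z.1 + z.2) := Finset.sum_nonneg fun i _ => mul_self_nonneg _
  have h3 : v ⬝ᵥ v + (z.1 + z.2) ⬝ᵥ (z.1 + z.2) = 2 * (z.1 ⬝ᵥ z.1 + z.2 ⬝ᵥ z.2) := by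
    simp only [hv, sub_dotProduct, dotProduct_sub, add_dotProduct, dotProduct_add]
    ring
  have h4 : (v - A *ᵥ v) ⬝ᵥ (v - A *ᵥ v) = v ⬝ᵥ v - v ⬝ᵥ A *ᵥ v := by
    rw [sub_dotProduct, dotProduct_sub (A *ᵥ v), ← dotProduct_mulVec_eq_of_projection hs hi,
      dotProduct_comm (A *ᵥ v) v, sub_self, sub_zero, dotProduct_sub v v]
  rw [pairForm, ← hv]
  linarith

theorem trace_mul_vecMulVec (A : Matrix ι ι ℝ) (v : ι → ℝ) :
    (A * Matrix.vecMulVec v v).trace = v ⬝ᵥ A *ᵥ v := by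
  rw [Matrix.mul_vecMulVec, Matrix.trace_vecMulVec, dotProduct_comm]

theorem trace_mul_empiricalCov {n : ℕ} (hn : n ≠ 0) (A : Matrix ι ι ℝ) (y : Fin n → ι → ℝ) :
    (A * ((1 / (n : ℝ)) • ∑ i, (Matrix.vecMulVec (y i) (y i) -
      Matrix.vecMulVec ((1 / (n : ℝ)) • ∑ i, y i) ((1 / (n : ℝ)) • ∑ i, y i)))).trace =
    (∑ i, ∑ j, pairForm A (y i, y j)) / (n : ℝ) ^ 2 := by
  have hn' : (n : ℝ) ≠ 0 := by exact_mod_cast hn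
  have h1 : ∑ i, ∑ j, pairForm A (y i, y j) =
      n * ∑ i, y i ⬝ᵥ A *ᵥ y i - (∑ i, y i) ⬝ᵥ A *ᵥ (∑ i, y i) := by
    have e : ∀ i j, pairForm A (y i, y j) = (y i ⬝ᵥ A *ᵥ y i + y j ⬝ᵥ A *ᵥ y j) / 2
        - (y i ⬝ᵥ A *ᵥ y j + y j ⬝ᵥ A *ᵥ y i) / 2 := fun i j => by
      simp only [pairForm, sub_dotProduct, Matrix.mulVec_sub, dotProduct_sub]
      ring
    have e2 : (∑ i, y i) ⬝ᵥ A *ᵥ (∑ i, y i) = ∑ i, ∑ j, y i ⬝ᵥ A *ᵥ y j := by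
      simp only [sum_dotProduct, Matrix.mulVec_sum, dotProduct_sum]
      exact Finset.sum_comm
    have e3 : ∑ i, ∑ j, y j ⬝ᵥ A *ᵥ y i = ∑ i, ∑ j, y i ⬝ᵥ A *ᵥ y j := Finset.sum_comm
    simp only [e, Finset.sum_sub_distrib, ← Finset.sum_div, Finset.sum_add_distrib, e3, e2,
      Finset.sum_const, Finset.card_univ, Fintype.card_fin, nsmul_eq_mul, ← Finset.mul_sum]
    ring
  rw [h1, Matrix.mul_smul, Matrix.trace_smul, Matrix.mul_sum, Matrix.trace_sum]
  simp only [Matrix.mul_sub, Matrix.trace_sub, trace_mul_vecMulVec, Finset.sum_sub_distrib,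
    Finset.sum_const, Finset.card_univ, Fintype.card_fin, nsmul_eq_mul, smul_eq_mul,
    Matrix.mulVec_smul, smul_dotProduct, dotProduct_smul]
  field_simp

variable {μ : Measure (ι → ℝ)} [IsProbabilityMeasure μ]

/-- Expand the product: the two like terms give `E (f g)` each, the two cross terms factor by
independence. -/
theorem integral_sub_mul_sub_prod {α : Type*} [MeasurableSpace α] {ν : Measure α}
    [IsProbabilityMeasure ν] {f g : α → ℝ} (hf : MemLp f 2 ν) (hg : MemLp g 2 ν) :
    Integrable (fun z : α × α => (f z.1 - f z.2) * (g z.1 - g z.2)) (ν.prod ν) ∧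
    ∫ z : α × α, (f z.1 - f z.2) * (g z.1 - g z.2) ∂ν.prod ν = 2 * cov[f, g; ν] := by
  have hf1 := hf.integrable one_le_two
  have hg1 := hg.integrable one_le_two
  have hfg : Integrable (fun x => f x * g x) ν := hf.integrable_mul hg
  have i1 : Integrable (fun z : α × α => f z.1 * g z.1) (ν.prod ν) := hfg.comp_fst ν
  have i2 : Integrable (fun z : α × α => f z.2 * g z.2) (ν.prod ν) := hfg.comp_snd ν
  have i3 : Integrable (fun z : α × α => f z.1 * g z.2) (ν.prod ν) := hf1.mul_prod hg1
  have i4 : Integrable (fun z : α × α => g z.1 * f z.2) (ν.prod ν) := hg1.mul_prod hf1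
  have e : (fun z : α × α => (f z.1 - f z.2) * (g z.1 - g z.2)) = fun z =>
      (f z.1 * g z.1 + f z.2 * g z.2) - (f z.1 * g z.2 + g z.1 * f z.2) := by
    funext z; ring
  have i12 : Integrable (fun z : α × α => f z.1 * g z.1 + f z.2 * g z.2) (ν.prod ν) := i1.add i2
  have i34 : Integrable (fun z : α × α => f z.1 * g z.2 + g z.1 * f z.2) (ν.prod ν) := i3.add i4
  rw [e]
  refine ⟨i12.sub i34, ?_⟩
  have a1 : ∫ z : α × α, f z.1 * g z.1 ∂ν.prod ν = ∫ x, f x * g x ∂ν := by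
    simpa using integral_fun_fst (μ := ν) (ν := ν) fun x => f x * g x
  have a2 : ∫ z : α × α, f z.2 * g z.2 ∂ν.prod ν = ∫ x, f x * g x ∂ν := by
    simpa using integral_fun_snd (μ := ν) (ν := ν) fun x => f x * g x
  rw [integral_sub i12 i34, integral_add i1 i2, integral_add i3 i4, a1, a2,
    integral_prod_mul f g, integral_prod_mul g f, covariance_eq_sub hf hg]
  simp only [Pi.mul_apply]
  ring

theorem integral_pairForm (A : Matrix ι ι ℝ) (hμ : ∀ a, MemLp (fun y : ι → ℝ => y a) 2 μ) :
    ∫ z, pairForm A z ∂μ.prod μ =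
      (A * Matrix.of fun a b => cov[fun y : ι → ℝ => y a, fun y => y b; μ]).trace := by
  have h := fun a b => integral_sub_mul_sub_prod (hμ a) (hμ b)
  simp only [pairForm_eq_sum]
  rw [integral_finsetSum _ fun a _ => integrable_finsetSum _ fun b _ => (h a b).1.const_mul _]
  simp only [Matrix.trace, Matrix.diag_apply, Matrix.mul_apply, Matrix.of_apply]
  refine Finset.sum_congr rfl fun a _ => ?_
  rw [integral_finsetSum _ fun b _ => (h a b).1.const_mul _]
  refine Finset.sum_congr rfl fun b _ => ?_
  rw [integral_const_mul, (h a b).2, covariance_comm]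
  ring

theorem memLp_two_coord {b : ℝ} (hb1 : 1 ≤ b) (hb : Integrable (fun y : ι → ℝ => (y ⬝ᵥ y) ^ b) μ)
    (a : ι) : MemLp (fun y : ι → ℝ => y a) 2 μ := by
  have h0 : ∀ y : ι → ℝ, 0 ≤ y ⬝ᵥ y := fun y => Finset.sum_nonneg fun i _ => mul_self_nonneg _
  have hm : Measurable fun y : ι → ℝ => y ⬝ᵥ y := by
    simp only [dotProduct]; fun_prop
  have h1 : Integrable (fun y : ι → ℝ => y ⬝ᵥ y) μ := by
    simpa using integrable_rpow_of_le hm.aestronglyMeasurable h0 zero_le_one hb1 hb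
  rw [memLp_two_iff_integrable_sq (measurable_pi_apply a).aestronglyMeasurable]
  refine h1.mono' ((measurable_pi_apply a).pow_const 2).aestronglyMeasurable (ae_of_all _ fun y => ?_)
  rw [Real.norm_eq_abs, abs_of_nonneg (sq_nonneg _), sq]
  exact Finset.single_le_sum (f := fun i => y i * y i) (fun i _ => mul_self_nonneg _)
    (Finset.mem_univ a)

theorem pairForm_rpow_moment {A : Matrix ι ι ℝ} (hs : Aᵀ = A) (hi : A * A = A) {b : ℝ}
    (hb0 : 0 ≤ b) (hb : Integrable (fun y : ι → ℝ => (y ⬝ᵥ y) ^ b) μ) :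
    Integrable (fun z => pairForm A z ^ b) (μ.prod μ) ∧
    ∫ z, pairForm A z ^ b ∂μ.prod μ ≤ 2 ^ (b + 1) * ∫ y, (y ⬝ᵥ y) ^ b ∂μ := by
  have h0 : ∀ y : ι → ℝ, 0 ≤ y ⬝ᵥ y := fun y => Finset.sum_nonneg fun i _ => mul_self_nonneg _
  -- Bounding the sum of squared lengths by twice the larger one works for every `b ≥ 0`.
  have hle : ∀ z : (ι → ℝ) × (ι → ℝ), pairForm A z ^ b ≤
      2 ^ b * ((z.1 ⬝ᵥ z.1) ^ b + (z.2 ⬝ᵥ z.2) ^ b) := fun z => by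
    have n1 := Real.rpow_nonneg (h0 z.1) b
    have n2 := Real.rpow_nonneg (h0 z.2) b
    have hA := pairForm_nonneg hs hi z
    have hB := pairForm_le hs hi z
    rcases le_total (z.1 ⬝ᵥ z.1) (z.2 ⬝ᵥ z.2) with h | h
    · calc pairForm A z ^ b ≤ (2 * (z.2 ⬝ᵥ z.2)) ^ b :=
            Real.rpow_le_rpow hA (by linarith) hb0
        _ = 2 ^ b * (z.2 ⬝ᵥ z.2) ^ b := Real.mul_rpow zero_le_two (h0 _)
        _ ≤ _ := by gcongr; linarith
    · calc pairForm A z ^ b ≤ (2 * (z.1 ⬝ᵥ z.1)) ^ b :=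
            Real.rpow_le_rpow hA (by linarith) hb0
        _ = 2 ^ b * (z.1 ⬝ᵥ z.1) ^ b := Real.mul_rpow zero_le_two (h0 _)
        _ ≤ _ := by gcongr; linarith
  have i1 : Integrable (fun z : (ι → ℝ) × (ι → ℝ) => (z.1 ⬝ᵥ z.1) ^ b) (μ.prod μ) := hb.comp_fst μ
  have i2 : Integrable (fun z : (ι → ℝ) × (ι → ℝ) => (z.2 ⬝ᵥ z.2) ^ b) (μ.prod μ) := hb.comp_snd μ
  have hI := (i1.add i2).const_mul (2 ^ b)
  have hn : ∀ z, 0 ≤ pairForm A z ^ b := fun z => Real.rpow_nonneg (pairForm_nonneg hs hi z) _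
  have hint : Integrable (fun z => pairForm A z ^ b) (μ.prod μ) := by
    refine hI.mono' ((measurable_pairForm A).pow_const b).aestronglyMeasurable
      (ae_of_all _ fun z => ?_)
    rw [Real.norm_eq_abs, abs_of_nonneg (hn z)]
    exact hle z
  refine ⟨hint, (integral_mono hint hI hle).trans (le_of_eq ?_)⟩
  simp only [Pi.add_apply]
  rw [integral_const_mul, integral_add i1 i2]
  have a1 : ∫ z : (ι → ℝ) × (ι → ℝ), (z.1 ⬝ᵥ z.1) ^ b ∂μ.prod μ = ∫ y, (y ⬝ᵥ y) ^ b ∂μ := by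
    simpa using integral_fun_fst (μ := μ) (ν := μ) fun y : ι → ℝ => (y ⬝ᵥ y) ^ b
  have a2 : ∫ z : (ι → ℝ) × (ι → ℝ), (z.2 ⬝ᵥ z.2) ^ b ∂μ.prod μ = ∫ y, (y ⬝ᵥ y) ^ b ∂μ := by
    simpa using integral_fun_snd (μ := μ) (ν := μ) fun y : ι → ℝ => (y ⬝ᵥ y) ^ b
  rw [a1, a2, Real.rpow_add_one two_ne_zero]
  ring

end PairForm

/-! ### From paths to vectorised observations -/

section Observations

variable {T Ω : Type*} [MeasurableSpace Ω] {p : ℕ}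

theorem measurable_obsVec (t : Fin p → T) : Measurable (obsVec t) :=
  measurable_pi_lambda _ fun a =>
    (measurable_pi_apply (t a.2)).mul (measurable_pi_apply (t a.1))

/-- The Frobenius norm is the Euclidean norm of the vectorisation, so order `β` becomes order `β /
2` in the squared length. -/
theorem frob_obsSq_rpow (t : Fin p → T) (path : T → ℝ) (β : ℝ) :
    frob (obsSq t path) ^ β = (obsVec t path ⬝ᵥ obsVec t path) ^ (β / 2) := by
  have h0 : 0 ≤ obsVec t path ⬝ᵥ obsVec t path := Finset.sum_nonneg fun i _ => mul_self_nonneg _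
  rw [frob, Matrix.trace_mul_comm, ← Matrix.vec_dotProduct_vec]
  change Real.sqrt (obsVec t path ⬝ᵥ obsVec t path) ^ β = _
  rw [Real.sqrt_eq_rpow, ← Real.rpow_mul h0, one_div_mul_eq_div]

variable {P : Measure Ω} {X : T → Ω → ℝ} {t : Fin p → T}

theorem measurable_obsVec_process (hX : ∀ s, Measurable (X s)) :
    Measurable fun ω => obsVec t fun s => X s ω :=
  (measurable_obsVec t).comp (measurable_pi_lambda _ hX)

theorem phiMat_eq_cov_map (hX : ∀ s, Measurable (X s)) :
    phiMat t X P = Matrix.of fun a b => cov[fun y : Fin p × Fin p → ℝ => y a, fun y => y b;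
      P.map fun ω => obsVec t fun s => X s ω] := by
  ext a b
  simp only [phiMat, Matrix.of_apply]
  rw [covariance_map_fun (measurable_pi_apply a).aestronglyMeasurable
    (measurable_pi_apply b).aestronglyMeasurable (measurable_obsVec_process hX).aemeasurable]

theorem integrable_moment_map (hX : ∀ s, Measurable (X s)) {β : ℝ}
    (hβ : Integrable (fun ω => frob (obsSq t fun s => X s ω) ^ β) P) :
    Integrable (fun y : Fin p × Fin p → ℝ => (y ⬝ᵥ y) ^ (β / 2))
      (P.map fun ω => obsVec t fun s => X s ω) := by
  have hm : Measurable fun y : Fin p × Fin p → ℝ => (y ⬝ᵥ y) ^ (β / 2) := by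
    simp only [dotProduct]; fun_prop
  rw [integrable_map_measure hm.aestronglyMeasurable (measurable_obsVec_process hX).aemeasurable]
  simpa only [frob_obsSq_rpow, Function.comp_def] using hβ

theorem normMoment_eq_map (hX : ∀ s, Measurable (X s)) (β : ℝ) :
    normMoment t X P β = ∫ y : Fin p × Fin p → ℝ, (y ⬝ᵥ y) ^ (β / 2)
      ∂(P.map fun ω => obsVec t fun s => X s ω) := by
  have hm : Measurable fun y : Fin p × Fin p → ℝ => (y ⬝ᵥ y) ^ (β / 2) := by
    simp only [dotProduct]; fun_prop
  rw [integral_map (measurable_obsVec_process hX).aemeasurable hm.aestronglyMeasurable]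
  simp only [normMoment, frob_obsSq_rpow]

theorem projTrace_phiHat {Λ : Type*} {n : ℕ} (hn : n ≠ 0) (g : Λ → T → ℝ)
    (paths : Fin n → T → ℝ) (m : Finset Λ) :
    projTrace g t (phiHat t paths) m =
      (∑ i, ∑ j, pairForm (proj g t m ⊗ₖ proj g t m) (obsVec t (paths i), obsVec t (paths j))) /
        (n : ℝ) ^ 2 :=
  trace_mul_empiricalCov hn _ _

end Observations

/-! ### Exponents, constants and the deviation bound for one model -/

/-- The tail order attained with moments of order `β`. -/
noncomputable def tailOrder (β : ℝ) : ℝ := β / 2 - β / 2 / min (β / 2) 2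

/-- The order is `β / 2 - 1` for `β ≤ 4` and `β / 4` for `β ≥ 4`; these match the two upper bounds
on `κ`. -/
theorem div_four_le_tailOrder {β κ : ℝ} (hβ : 2 < β) (h1 : κ < β) (h2 : κ < 2 * β - 4) :
    κ / 4 ≤ tailOrder β := by
  rw [tailOrder]
  rcases le_total (β / 2) 2 with h | h
  · rw [min_eq_left h, div_self (by linarith)]
    linarith
  · rw [min_eq_right h]
    linarith

/-- The constant of the deviation bound, as a function of the moment order. -/
noncomputable def deviationConst (β : ℝ) : ℝ :=
  -- The factors come from the exponential bound, from `⌊n / 2⌋ ≥ n / 4`, from the threshold `α τ /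
  -- 4` and from the moment of the pair form; the maximum ensures positivity for every real `β`.
  max 1 (tailOrder β ^ tailOrder β * 4 ^ tailOrder β * 4 ^ (β / 2) * 2 ^ (β / 2 + 1))

theorem rpow_neg_half_le {n : ℕ} (hn : 2 ≤ n) {s c : ℝ} (hs : 0 ≤ s) (hc : c ≤ s) :
    ((n / 2 : ℕ) : ℝ) ^ (-s) ≤ 4 ^ s * (n : ℝ) ^ (-c) := by
  have hn1 : (1 : ℝ) ≤ n := by exact_mod_cast (by omega : 1 ≤ n)
  have h1 : (n : ℝ) / 4 ≤ ((n / 2 : ℕ) : ℝ) := by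
    rw [div_le_iff₀ (by norm_num)]
    exact_mod_cast (by omega : n ≤ n / 2 * 4)
  calc ((n / 2 : ℕ) : ℝ) ^ (-s) ≤ ((n : ℝ) / 4) ^ (-s) :=
        Real.rpow_le_rpow_of_nonpos (by positivity) h1 (by linarith)
    _ = 4 ^ s * (n : ℝ) ^ (-s) := by
        rw [Real.div_rpow (by positivity) (by norm_num), Real.rpow_neg (by norm_num : (0:ℝ) ≤ 4),
          div_inv_eq_mul, mul_comm]
    _ ≤ 4 ^ s * (n : ℝ) ^ (-c) := by
        gcongr

/-- Replacing `n²` by `n (n - 1)` multiplies by `n / (n - 1)`; halving `α` absorbs this once `n α ≥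
2`. -/
theorem le_pair_mean_of_le {n : ℕ} {α S τ : ℝ} (hα : 0 < α) (hn : 2 ≤ n) (hnα : 2 / α ≤ n)
    (hτ : 0 < τ) (hS : S / (n : ℝ) ^ 2 ≤ (1 - α) * τ) :
    S / ((n : ℝ) * (n - 1)) ≤ (1 - α / 2) * τ := by
  have hn2 : (2 : ℝ) ≤ n := by exact_mod_cast hn
  rw [div_le_iff₀ hα] at hnα
  rw [div_le_iff₀ (by positivity)] at hS
  rw [div_le_iff₀ (mul_pos (by linarith) (by linarith))]
  refine hS.trans ?_
  have : 0 ≤ τ * n * ((1 - α / 2) * (n - 1) - (1 - α) * n) :=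
    mul_nonneg (by positivity) (by nlinarith)
  linarith

theorem measureReal_deltaHatSq_le {T Λ Ω₀ Ω : Type*} [MeasurableSpace Ω₀] [MeasurableSpace Ω]
    {P : Measure Ω₀} [IsProbabilityMeasure P] {Q : Measure Ω} [IsProbabilityMeasure Q] {p n : ℕ}
    {t : Fin p → T} {X : T → Ω₀ → ℝ} {Xs : Fin n → T → Ω → ℝ} {g : Λ → T → ℝ} {m : Finset Λ}
    {β κ α : ℝ} (hβ : 2 < β) (h1 : κ < β) (h2 : κ < 2 * β - 4) (hκ : 0 < κ) (hα : 0 < α)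
    (hX : ∀ s, Measurable (X s))
    (hmom : Integrable (fun ω => frob (obsSq t fun s => X s ω) ^ β) P)
    (hD : 0 < dimM g t m) (hτ : 0 < projTrace g t (phiMat t X P) m)
    (hn : 2 ≤ n) (hnα : 2 / α ≤ n)
    (hind : iIndepFun (fun i ω s => Xs i s ω) Q)
    (hid : ∀ i, IdentDistrib (fun ω s => Xs i s ω) (fun ω s => X s ω) Q P) :
    Q.real {ω | deltaHatSq g t (fun i s => Xs i s ω) m ≤ (1 - α) * deltaSq g t X P m} ≤
      (n : ℝ) ^ (-(κ / 4)) * (deviationConst β * (1 / α ^ (β / 2))) * normMoment t X P β *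
        delta g t X P m ^ (-β) * dimM g t m ^ (-(β / 2)) := by
  obtain ⟨hs, hi⟩ := proj_kronecker_transpose_and_sq g t m
  have hYm := measurable_obsVec_process (t := t) hX
  have hμ : IsProbabilityMeasure (P.map fun ω => obsVec t fun s => X s ω) :=
    Measure.isProbabilityMeasure_map hYm.aemeasurable
  have hb := integrable_moment_map hX hmom
  have hN := normMoment_eq_map (P := P) (t := t) hX β
  have hcov := integral_pairForm (proj g t m ⊗ₖ proj g t m)
    (memLp_two_coord (by linarith : 1 ≤ β / 2) hb)
  rw [← phiMat_eq_cov_map hX] at hcov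
  change _ = projTrace g t (phiMat t X P) m at hcov
  have hYi : iIndepFun (fun i ω => obsVec t fun s => Xs i s ω) Q :=
    hind.comp (fun _ => obsVec t) fun _ => measurable_obsVec t
  have hlaw : ∀ i, IdentDistrib (fun ω => obsVec t fun s => Xs i s ω)
      (fun ω => obsVec t fun s => X s ω) Q P := fun i => (hid i).comp (measurable_obsVec t)
  obtain ⟨hI, hIle⟩ := pairForm_rpow_moment hs hi (by linarith : 0 ≤ β / 2) hb
  have hr : 1 < min (β / 2) 2 := lt_min (by linarith) one_lt_two
  have htail := measureReal_pair_average_le (k := n / 2) hYi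
    (fun i => (hlaw i).aemeasurable_fst) (fun i => (hlaw i).map_eq) (by omega)
    (by rw [Fintype.card_fin]; omega) (measurable_pairForm (proj g t m ⊗ₖ proj g t m))
    (pairForm_nonneg hs hi) (pairForm_self _) hr (min_le_right _ _) (min_le_left _ _)
    (half_pos hα) hI (by rw [hcov]; exact hτ)
  change _ ≤ tailOrder β ^ tailOrder β * _ ^ (-tailOrder β) * _ at htail
  rw [hcov, Fintype.card_fin] at htail
  rw [← hN] at hIle
  have hord := div_four_le_tailOrder hβ h1 h2
  have hord0 : 0 < tailOrder β := by linarith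
  set τ := projTrace g t (phiMat t X P) m with hτdef
  set N := normMoment t X P β
  have hN0 : 0 ≤ N := by
    refine integral_nonneg fun ω => Real.rpow_nonneg (Real.sqrt_nonneg _) _
  -- Since `δ_m² D_m = τ`, the dimension cancels.
  have hδ : delta g t X P m ^ (-β) * dimM g t m ^ (-(β / 2)) = τ ^ (-(β / 2)) := by
    have hq : 0 ≤ τ / dimM g t m := by positivity
    rw [delta, deltaSq, ← hτdef, Real.sqrt_eq_rpow, ← Real.rpow_mul hq,
      show 1 / 2 * -β = -(β / 2) by ring, ← Real.mul_rpow hq hD.le, div_mul_cancel₀ _ hD.ne']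
  have hscale : (α / 2 * τ / 2) ^ (-(β / 2)) =
      4 ^ (β / 2) * (1 / α ^ (β / 2)) * τ ^ (-(β / 2)) := by
    rw [show α / 2 * τ / 2 = 4⁻¹ * α * τ by ring, Real.mul_rpow (by positivity) hτ.le,
      Real.mul_rpow (by norm_num) hα.le, Real.rpow_neg (by norm_num), Real.inv_rpow (by norm_num),
      inv_inv, Real.rpow_neg hα.le, one_div]
  calc Q.real {ω | deltaHatSq g t (fun i s => Xs i s ω) m ≤ (1 - α) * deltaSq g t X P m}
      ≤ _ := measureReal_mono fun ω hω => by
        simp only [Set.mem_ofPred_eq, deltaHatSq, deltaSq, ← hτdef] at hω ⊢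
        rw [← mul_div_assoc, div_le_div_iff_of_pos_right hD, projTrace_phiHat (by omega)] at hω
        exact le_pair_mean_of_le hα hn hnα hτ hω
    _ ≤ _ := htail
    _ ≤ tailOrder β ^ tailOrder β * (4 ^ tailOrder β * (n : ℝ) ^ (-(κ / 4))) *
        ((α / 2 * τ / 2) ^ (-(β / 2)) * (2 ^ (β / 2 + 1) * N)) := by
        have := rpow_neg_half_le hn hord0.le hord
        have hIn : 0 ≤ ∫ z, pairForm (proj g t m ⊗ₖ proj g t m) z ^ (β / 2)
            ∂(P.map fun ω => obsVec t fun s => X s ω).prod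
              (P.map fun ω => obsVec t fun s => X s ω) :=
          integral_nonneg fun z => Real.rpow_nonneg (pairForm_nonneg hs hi z) _
        gcongr
    _ = tailOrder β ^ tailOrder β * 4 ^ tailOrder β * 4 ^ (β / 2) * 2 ^ (β / 2 + 1) *
        ((n : ℝ) ^ (-(κ / 4)) * (1 / α ^ (β / 2)) * N * τ ^ (-(β / 2))) := by
        rw [hscale]; ring
    _ ≤ deviationConst β * ((n : ℝ) ^ (-(κ / 4)) * (1 / α ^ (β / 2)) * N * τ ^ (-(β / 2))) :=
        mul_le_mul_of_nonneg_right (le_max_right _ _) (by positivity)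
    _ = _ := by rw [← hδ]; ring

/-- The claim amounts to `6 q ≤ κ`, and `κ > 2 + 4 q ≥ 6 q` because `q ≤ 1`. -/
theorem div_one_sub_le_div_four {q κ : ℝ} (hq : 0 < q) (hq1 : q ≤ 1)
    (hκ : 2 * (1 + 2 * q) < κ) : q / (1 - 2 * q / κ) ≤ κ / 4 := by
  have hκ0 : 0 < κ := by linarith
  have h1 : 1 - 2 * q / κ = (κ - 2 * q) / κ := by field_simp
  rw [h1, div_div_eq_mul_div, div_le_iff₀ (by linarith)]
  nlinarith

theorem projTrace_pos_of_cInf_pos {T Λ Ω : Type*} [MeasurableSpace Ω] {P : Measure Ω} {p : ℕ}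
    {t : Fin p → T} {X : T → Ω → ℝ} {g : Λ → T → ℝ} {M : Finset (Finset Λ)}
    (h : 0 < cInf g t X P M) {m : Finset Λ} (hm : m ∈ M) :
    0 < projTrace g t (phiMat t X P) m :=
  h.trans_le (ciInf_le (Set.finite_range _).bddBelow (⟨m, hm⟩ : M))

end CovSel

/-! ### The proposition -/

open CovSel

theorem mainTheorem3 :
    -- the constants depend on `β` only, the threshold on `κ, β, α, C_inf, Σ` only
    ∃ (C₁ C₂ : ℝ → ℝ)
      (n₀ : (κ β α Cinf : ℝ) → (p : ℕ) → (Sig : Matrix (Fin p) (Fin p) ℝ) → ℕ),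
    (∀ β, 0 < C₁ β ∧ 0 < C₂ β) ∧
    ∀ (q β κ α : ℝ), 0 < q → q ≤ 1 →
      max (2 * (1 + 2 * q)) (3 + 2 * q) < β →
      κ ∈ Set.Ioo (2 * (1 + 2 * q)) (min β (2 * β - 4)) →
      α ∈ Set.Ioo (0 : ℝ) 1 →
    -- the centred second-order process `X`, observed at `t_1, …, t_p`
    ∀ (d : ℕ) (T : Set (EuclideanSpace ℝ (Fin d))) (p : ℕ) (t : Fin p → T)
      (Ω₀ : Type*) [MeasurableSpace Ω₀] (P : Measure Ω₀) [IsProbabilityMeasure P]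
      (X : T → Ω₀ → ℝ),
      (∀ s, Measurable (X s)) → (∀ s, MemLp (X s) 2 P) → (∀ s, ∫ ω, X s ω ∂P = 0) →
      Integrable (fun ω => frob (obsSq t (fun s => X s ω)) ^ β) P →
    -- the finite collection of models
    ∀ (Λ : Type*) [Countable Λ] (g : Λ → T → ℝ) (M : Finset (Finset Λ)),
      (∀ m ∈ M, 0 < dimM g t m) → 0 < cInf g t X P M →
    -- the sample of `n` independent copies of `X`
    ∀ (n : ℕ), n₀ κ β α (cInf g t X P M) p (sigmaMat t X P) ≤ n →
    ∀ (Ω : Type*) [MeasurableSpace Ω] (Q : Measure Ω) [IsProbabilityMeasure Q]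
      (Xs : Fin n → T → Ω → ℝ),
      iIndepFun (fun i ω s => Xs i s ω) Q →
      (∀ i, IdentDistrib (fun ω s => Xs i s ω) (fun ω s => X s ω) Q P) →
      q / (1 - 2 * q / κ) ≤ κ / 4 ∧
      (∀ m ∈ M,
        Q.real {ω | deltaHatSq g t (fun i s => Xs i s ω) m ≤ (1 - α) * deltaSq g t X P m} ≤
          (n : ℝ) ^ (-(κ / 4)) *
            (C₂ β * 2 ^ (β + 1) + C₁ β * (1 / α ^ (β / 2))) * normMoment t X P β *
            delta g t X P m ^ (-β) * dimM g t m ^ (-(β / 2))) ∧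
      Q.real (⋂ m ∈ M,
          {ω | (1 - α) * deltaSq g t X P m ≤ deltaHatSq g t (fun i s => Xs i s ω) m})ᶜ ≤
        ((C₂ β * 2 ^ (β + 1) + C₁ β * (1 / α ^ (β / 2))) * normMoment t X P β *
            ∑ m ∈ M, delta g t X P m ^ (-β) * dimM g t m ^ (-(β / 2))) *
          (n : ℝ) ^ (-(κ / 4)) := by
  -- The threshold gives at least one pair and `n ≥ 2 / α`.
  refine ⟨deviationConst, fun _ => 1, fun _ _ α _ _ _ => max 2 ⌈2 / α⌉₊,
    fun β => ⟨lt_of_lt_of_le one_pos (le_max_left _ _), one_pos⟩, ?_⟩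
  intro q β κ α hq hq1 hβ hκ hα d T p t Ω₀ _ P _ X hX _ _ hmom Λ _ g M hD hC n hn Ω _ Q _ Xs
    hind hid
  obtain ⟨hκβ, hκβ'⟩ := lt_min_iff.1 hκ.2
  have hκ1 := hκ.1
  have hdev : ∀ m ∈ M,
      Q.real {ω | deltaHatSq g t (fun i s => Xs i s ω) m ≤ (1 - α) * deltaSq g t X P m} ≤
        (n : ℝ) ^ (-(κ / 4)) *
          (1 * 2 ^ (β + 1) + deviationConst β * (1 / α ^ (β / 2))) * normMoment t X P β *
          delta g t X P m ^ (-β) * dimM g t m ^ (-(β / 2)) := fun m hm => by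
    refine (measureReal_deltaHatSq_le (by linarith) hκβ hκβ' (by linarith) hα.1 hX hmom (hD m hm)
      (projTrace_pos_of_cInf_pos hC hm) ((le_max_left _ _).trans hn)
      (Nat.ceil_le.1 ((le_max_right _ _).trans hn)) hind hid).trans ?_
    have hN : 0 ≤ normMoment t X P β :=
      integral_nonneg fun ω => Real.rpow_nonneg (Real.sqrt_nonneg _) _
    have hδ : 0 ≤ delta g t X P m ^ (-β) := Real.rpow_nonneg (Real.sqrt_nonneg _) _
    have hDm : 0 ≤ dimM g t m ^ (-(β / 2)) := Real.rpow_nonneg (hD m hm).le _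
    gcongr
    -- The one-model bound needs only the `C₁` term; the `C₂` term is nonnegative slack.
    exact le_add_of_nonneg_left (by positivity)
  refine ⟨div_one_sub_le_div_four hq hq1 hκ.1, hdev, ?_⟩
  calc _ ≤ Q.real (⋃ m ∈ M,
        {ω | deltaHatSq g t (fun i s => Xs i s ω) m ≤ (1 - α) * deltaSq g t X P m}) := by
        refine measureReal_mono (fun ω hω => ?_) (measure_ne_top _ _)
        simp only [Set.mem_compl_iff, Set.mem_iInter, Set.mem_ofPred_eq, not_forall, not_le] at hω
        obtain ⟨m, hm, h⟩ := hω
        exact Set.mem_biUnion hm h.le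
    _ ≤ ∑ m ∈ M, Q.real
        {ω | deltaHatSq g t (fun i s => Xs i s ω) m ≤ (1 - α) * deltaSq g t X P m} :=
        measureReal_biUnion_finset_le _ _
    _ ≤ _ := Finset.sum_le_sum hdev
    _ = _ := by
        rw [Finset.mul_sum, Finset.sum_mul]
        exact Finset.sum_congr rfl fun m _ => by ring
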